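/- Let $X$ and $Y$ be complex Banach spaces, and write $L(Y,X)$ for the bounded linear operators from $Y$ to $X$ and $L(X)=L(X,X)$. An operator $T\in L(X)$ is Drazin invertible if there are a positive integer $k$ and $S\in L(X)$ with $ST=TS$, $T^{k+1}S=T^k$ and $S^2T=S$; it is generalized Drazin invertible if $0$ is not an accumulation point of its spectrum $\sigma(T)$. Put $$\sigma_D(T)=\{\lambda\in\mathbb{C}: T-\lambda I \text{ is not Drazin invertible}\},\qquad \sigma_{gD}(T)=\{\lambda\in\mathbb{C}: T-\lambda I \text{ is not generalized Drazin invertible}\}.$$ For $A\in L(X)$, $B\in L(Y)$ and $C\in L(Y,X)$ let $M_C=\begin{pmatrix}A&C\\0&B\end{pmatrix}\in L(X\oplus Y)$, that is, $M_C(x,y)=(Ax+Cy,\,By)$. Then for all such $A$, $B$, $C$ the following assertions are equivalent: 1. $\sigma(M_C)=\sigma(A)\cup\sigma(B)$; 2. $\sigma_D(M_C)=\sigma_D(A)\cup\sigma_D(B)$; 3. $\sigma_{gD}(M_C)=\sigma_{gD}(A)\cup\sigma_{gD}(B)$. -/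

import Mathlib

open Topology Filter

section DrazinSpectra

variable {X : Type*} [NormedAddCommGroup X] [NormedSpace ℂ X]
variable {Y : Type*} [NormedAddCommGroup Y] [NormedSpace ℂ Y]

/-- A bounded operator `T` is Drazin invertible if there are a positive integer `k` and a bounded
operator `S` with `S T = T S`, `T ^ (k + 1) S = T ^ k` and `S ^ 2 T = S`. -/
def IsDrazinInvertible (T : X →L[ℂ] X) : Prop :=
  ∃ k : ℕ, 0 < k ∧ ∃ S : X →L[ℂ] X,
    S * T = T * S ∧ T ^ (k + 1) * S = T ^ k ∧ S ^ 2 * T = S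

/-- The Drazin spectrum: all `z` such that `T - z I` is not Drazin invertible. -/
def drazinSpectrum (T : X →L[ℂ] X) : Set ℂ :=
  {z : ℂ | ¬ IsDrazinInvertible (T - z • (1 : X →L[ℂ] X))}

/-- A bounded operator `T` is generalized Drazin invertible if `0` is not an accumulation point
of its spectrum. -/
def IsGeneralizedDrazinInvertible (T : X →L[ℂ] X) : Prop :=
  ¬ AccPt (0 : ℂ) (𝓟 (spectrum ℂ T))

/-- The generalized Drazin spectrum: all `z` such that `T - z I` is not generalized Drazin
invertible. -/
def generalizedDrazinSpectrum (T : X →L[ℂ] X) : Set ℂ :=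
  {z : ℂ | ¬ IsGeneralizedDrazinInvertible (T - z • (1 : X →L[ℂ] X))}

/-- The upper triangular operator matrix `(A C; 0 B)` acting on `X ⊕ Y` by
`(x, y) ↦ (A x + C y, B y)`. -/
def upperTriangularOp (A : X →L[ℂ] X) (B : Y →L[ℂ] Y) (C : Y →L[ℂ] X) :
    (X × Y) →L[ℂ] (X × Y) :=
  (A.comp (ContinuousLinearMap.fst ℂ X Y) + C.comp (ContinuousLinearMap.snd ℂ X Y)).prod
    (B.comp (ContinuousLinearMap.snd ℂ X Y))

/-- The action of the upper triangular operator matrix on a pair. -/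
theorem upperTriangularOp_apply (A : X →L[ℂ] X) (B : Y →L[ℂ] Y) (C : Y →L[ℂ] X) (x : X) (y : Y) :
    upperTriangularOp A B C (x, y) = (A x + C y, B y) := rfl

end DrazinSpectra

/-! ### Drazin inverses in rings. -/

section Ring

variable {R : Type*} [Ring R]

/-! If `M_C - z` is invertible, then `A - z` is left invertible, and `B - z` is invertible as soon
as `A - z` is. So assertion 1 fails only at a `z` where `M_C - z` is a unit and `A - z` is not. At
such a `z`, assertion 2 or 3 would make `A - z` Drazin or generalized Drazin invertible, and a left
invertible element of that kind is a unit (`isUnit_of_left_inverse_of_drazin`,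
`isUnit_of_left_inverse_of_eventually`).

Conversely, assertion 1 carries invertibility on a punctured disc from `M_C` to `A` and `B`, which
is 3. For 2, a Drazin inverse of `M_C` is a limit of triangular operators built from resolvents, so
it is triangular and its diagonal entries are Drazin inverses of `A` and `B`
(`IsDrazinInvertible.of_upperTriangularOp`). The inclusion of `σ_D(M_C)` in the union holds for
every `C`, by strong π-regularity. -/

/-- In a ring, if `a ^ n` is a left and a right multiple of `a ^ (n + 1)`, then `a` has a
Drazin inverse. -/
theorem exists_drazin_inverse_of_strongly_pi_regular {a x y : R} {n : ℕ}
    (hx : a ^ (n + 1) * x = a ^ n) (hy : y * a ^ (n + 1) = a ^ n) :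
    ∃ d : R, d * a = a * d ∧ a ^ (n + 1) * d = a ^ n ∧ d ^ 2 * a = d := by
  have hxy : a ^ n * x = y * a ^ n := by
    calc a ^ n * x = y * (a ^ (n + 1) * x) := by rw [← mul_assoc, hy]
      _ = y * a ^ n := by rw [hx]
  have hxj (j : ℕ) : a ^ n * x ^ j = y ^ j * a ^ n := by
    induction j with
    | zero => simp
    | succ j ih => rw [pow_succ, ← mul_assoc, ih, mul_assoc, hxy, ← mul_assoc, ← pow_succ]
  have hyj (j : ℕ) : y ^ j * a ^ (n + j) = a ^ n := by
    induction j with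
    | zero => simp
    | succ j ih =>
      calc y ^ (j + 1) * a ^ (n + (j + 1)) = y ^ j * (y * a ^ (n + 1)) * a ^ j := by
            rw [pow_succ, show n + (j + 1) = n + 1 + j by ring, pow_add a (n + 1) j]
            simp only [mul_assoc]
        _ = a ^ n := by rw [hy, mul_assoc, ← pow_add, ih]
  have hxj' (j : ℕ) : a ^ (n + j) * x ^ j = a ^ n := by
    rw [add_comm n j, pow_add, mul_assoc, hxj, ← mul_assoc]
    clear hyj
    induction j with
    | zero => simp
    | succ j ih =>
      rw [mul_assoc, ← hxj, ← mul_assoc, ← pow_add, pow_succ', ← mul_assoc,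
        show j + 1 + n = j + (n + 1) by ring, pow_add, mul_assoc (a ^ j), hx, mul_assoc, hxj,
        ← mul_assoc, ih]
  have had : a * (a ^ n * x ^ (n + 1)) = a ^ n * x ^ n := by
    rw [pow_succ' x, ← mul_assoc, ← mul_assoc, ← pow_succ', hx]
  have hda : a ^ n * x ^ (n + 1) * a = a ^ n * x ^ n := by
    rw [hxj, mul_assoc, ← pow_succ, pow_succ y, mul_assoc, hy, hxj]
  -- This witness also equals `y ^ (n + 1) * a ^ n`; having both forms is what makes it commute with
  -- `a`.
  refine ⟨a ^ n * x ^ (n + 1), hda.trans had.symm, ?_, ?_⟩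
  · have hc : Commute (a ^ n * x ^ (n + 1)) a := hda.trans had.symm
    rw [← (hc.pow_right (n + 1)).eq, hxj, mul_assoc, ← pow_add]
    exact hyj (n + 1)
  · rw [sq, mul_assoc, hda]
    nth_rewrite 1 [hxj]
    rw [mul_assoc, ← mul_assoc (a ^ n), ← pow_add, hxj', hxj]

theorem pow_add_add_mul_pow_of_drazin {a s : R} {k : ℕ} (hk : a ^ (k + 1) * s = a ^ k)
    (j m : ℕ) : a ^ (k + j + m) * s ^ m = a ^ (k + j) := by
  induction m with
  | zero => simp
  | succ m ih =>
    rw [pow_succ' s, ← mul_assoc, show k + j + (m + 1) = (j + m) + (k + 1) by ring, pow_add,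
      mul_assoc (a ^ (j + m)), hk, ← pow_add, show j + m + k = k + j + m by ring, ih]

/-- A left invertible element with a Drazin inverse is a unit. -/
theorem isUnit_of_left_inverse_of_drazin {a s l : R} {k : ℕ} (hl : l * a = 1)
    (hc : s * a = a * s) (hk : a ^ (k + 1) * s = a ^ k) : IsUnit a := by
  have hlk : l ^ k * a ^ k = 1 := by
    induction k with
    | zero => simp
    | succ k ih =>
      rw [pow_succ, pow_succ', mul_assoc, ← mul_assoc l, hl, one_mul]
      apply ih
      have := congrArg (l * ·) hk
      simpa only [pow_succ' a, ← mul_assoc, hl, one_mul] using this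
  have has : a * s = 1 := by
    have := congrArg (l ^ k * ·) hk
    simpa only [pow_succ, ← mul_assoc, hlk, one_mul] using this
  exact ⟨⟨a, s, has, hc.trans has⟩, rfl⟩

/-- A one-parameter version of the computation `(a - u) r = 1`, for `r` the resolvent and
`s` a Drazin inverse of `a`: on the range of `a ^ k` the resolvent is given by `s`. -/
theorem pow_inverse_mul_pow_of_drazin {a s r w : R} {k : ℕ} (u : R) (hu : Commute u s)
    (hua : Commute u a)
    (hc : s * a = a * s) (hk : a ^ (k + 1) * s = a ^ k) (hs : s ^ 2 * a = s)
    (hr : r * (a - u) = 1) (hw : (1 - u * s) * w = 1) (hw' : w * (1 - u * s) = 1) :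
    r ^ (k + 1) * a ^ k = w ^ (k + 1) * s := by
  have hsa : Commute s a := hc
  have hcw : ∀ {t : R}, Commute t (1 - u * s) → Commute t w := fun {t} ht => by
    let v : Rˣ := ⟨1 - u * s, w, hw, hw'⟩
    exact (show Commute t (v : R) from ht).units_inv_right
  have hsw : Commute s w := hcw ((Commute.one_right s).sub_right (hu.symm.mul_right rfl))
  have haw : Commute a w := hcw ((Commute.one_right a).sub_right (hua.symm.mul_right hsa.symm))
  have h1 : (a - u) * (s * a ^ k) = (1 - u * s) * a ^ k := by
    have : a * (s * a ^ k) = a ^ k := by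
      rw [← (hsa.pow_right k).symm.eq, ← mul_assoc, ← pow_succ', hk]
    rw [sub_mul, this, sub_mul, one_mul, mul_assoc]
  have h2 : r * a ^ k = (w * s) * a ^ k := by
    have h3 : (a - u) * ((w * s) * a ^ k) = a ^ k := by
      have haw' : Commute (a - u) w := by
        refine haw.sub_left (hcw ?_)
        exact (Commute.one_right u).sub_right ((Commute.refl u).mul_right hu)
      rw [mul_assoc w, ← mul_assoc, haw'.eq, mul_assoc, h1, ← mul_assoc, hw', one_mul]
    calc r * a ^ k = r * ((a - u) * ((w * s) * a ^ k)) := by rw [h3]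
      _ = _ := by rw [← mul_assoc, hr, one_mul]
  have hwsa : Commute (w * s) (a ^ k) := (haw.symm.mul_left hsa).pow_right k
  have h4 (j : ℕ) : r ^ j * a ^ k = (w * s) ^ j * a ^ k := by
    induction j with
    | zero => simp
    | succ j ih =>
      rw [pow_succ, mul_assoc, h2, hwsa.eq, ← mul_assoc, ih, mul_assoc, ← hwsa.eq, ← mul_assoc,
        ← pow_succ]
  -- The exponent `k + 1` on the resolvent is chosen so that `s ^ (k + 1) * a ^ k` collapses to `s`.
  have h5 (j : ℕ) : s ^ (j + 1) * a ^ j = s := by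
    induction j with
    | zero => simp
    | succ j ih =>
      rw [pow_succ', pow_succ a, mul_assoc, ← mul_assoc _ _ a, ih, ← mul_assoc]
      rw [← sq, hs]
  rw [h4, hsw.symm.mul_pow, mul_assoc, h5]

end Ring

/-! ### Perturbation by small scalars in a Banach algebra. -/

section BanachAlgebra

variable {R : Type*} [NormedRing R] [NormedAlgebra ℂ R] [CompleteSpace R]

theorem tendsto_inverse_one_sub_smul (s : R) :
    Tendsto (fun z : ℂ => Ring.inverse (1 - z • s)) (𝓝 0) (𝓝 1) := by
  have h1 : Tendsto (fun z : ℂ => 1 - z • s) (𝓝 0) (𝓝 ((1 : Rˣ) : R)) := by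
    have : Continuous (fun z : ℂ => 1 - z • s) := by fun_prop
    simpa using this.tendsto 0
  simpa [Function.comp_def] using (NormedRing.inverse_continuousAt (1 : Rˣ)).tendsto.comp h1

theorem eventually_isUnit_one_sub_smul (s : R) :
    ∀ᶠ z : ℂ in 𝓝 0, IsUnit (1 - z • s) := by
  have h1 : Tendsto (fun z : ℂ => 1 - z • s) (𝓝 0) (𝓝 (1 : R)) := by
    have : Continuous (fun z : ℂ => 1 - z • s) := by fun_prop
    simpa using this.tendsto 0
  exact h1.eventually (Units.isOpen.mem_nhds isUnit_one)

/-- If `a` has a Drazin inverse then `a - z` is invertible for all small `z ≠ 0`. -/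
theorem eventually_isUnit_sub_smul_of_drazin {a s : R} {k : ℕ}
    (hc : s * a = a * s) (hk : a ^ (k + 1) * s = a ^ k) (hs : s ^ 2 * a = s) :
    ∀ᶠ z : ℂ in 𝓝[≠] 0, IsUnit (a - z • 1) := by
  filter_upwards [(eventually_isUnit_one_sub_smul s).filter_mono nhdsWithin_le_nhds,
    self_mem_nhdsWithin] with z hz hz0
  have hsa : Commute s a := hc
  have hza : Commute a (z • (1 : R)) := (Commute.one_right a).smul_right z
  set q : R := ∑ i ∈ Finset.range k, a ^ i * (z • (1 : R)) ^ (k - 1 - i) with hq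
  have hqz : (a - z • 1) * q = a ^ k - z ^ k • 1 := by
    rw [hq, hza.mul_geom_sum₂, smul_pow, one_pow]
  have hqa : Commute a q := Commute.sum_right _ _ _ fun i _ =>
    ((Commute.refl a).pow_right i).mul_right (hza.pow_right _)
  have hqs : Commute s q := Commute.sum_right _ _ _ fun i _ =>
    (hsa.pow_right i).mul_right (((Commute.one_right s).smul_right z).pow_right _)
  -- The idempotent `p` splits off the part where `a` is nilpotent: there `-z⁻ᵏ q` inverts `a - z`,
  -- and on the complement `s (1 - z s)⁻¹` does. `h1` glues the two, cleared of denominators.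
  set p : R := 1 - a * s with hp
  have hkp : a ^ k * p = 0 := by rw [hp, mul_sub, mul_one, ← mul_assoc, ← pow_succ, hk, sub_self]
  have hps : p * s = 0 := by
    rw [hp, sub_mul, one_mul, ← hc, mul_assoc, ← hc, ← mul_assoc, ← sq, hs, sub_self]
  have hpa : Commute a p :=
    (Commute.one_right a).sub_right ((Commute.refl a).mul_right hsa.symm)
  have h1 : (a - z • 1) * (z ^ k • s - q * p) = z ^ k • (1 - z • s) := by
    rw [mul_sub, ← mul_assoc, hqz, sub_mul, sub_mul, hkp, mul_smul_comm, smul_mul_assoc, one_mul,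
      hp]
    simp only [smul_mul_assoc, one_mul, smul_sub, zero_sub, sub_neg_eq_add]
    rw [smul_comm z]
    abel
  have hcomm : Commute (a - z • 1) (z ^ k • s - q * p) := by
    have h2 : Commute a (z ^ k • s - q * p) :=
      (hsa.symm.smul_right _).sub_right (hqa.mul_right hpa)
    exact h2.sub_left ((Commute.one_left _).smul_left z)
  have hu : IsUnit (z ^ k • (1 - z • s)) := by
    have := hz.smul (Units.mk0 (z ^ k) (pow_ne_zero k hz0))
    simpa [Units.smul_def] using this
  rw [← h1] at hu
  exact (hcomm.isUnit_mul_iff.1 hu).1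

/-- A left invertible element which is a limit of units `a - z` is itself a unit. -/
theorem isUnit_of_left_inverse_of_eventually {a l : R} (hl : l * a = 1)
    (h : ∀ᶠ z : ℂ in 𝓝[≠] 0, IsUnit (a - z • 1)) : IsUnit a := by
  -- Since `l (a - z) = 1 - z l`, the second factor is a left inverse of `a - z`, hence two-sided
  -- when `a - z` is a unit. The product is then 1, and letting `z → 0` gives `a l = 1`.
  have h1 : Tendsto (fun z : ℂ => (a - z • 1) * (Ring.inverse (1 - z • l) * l)) (𝓝[≠] 0)
      (𝓝 (a * (1 * l))) := by
    have h2 : Tendsto (fun z : ℂ => a - z • (1 : R)) (𝓝 0) (𝓝 a) := by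
      have : Continuous (fun z : ℂ => a - z • (1 : R)) := by fun_prop
      simpa using this.tendsto 0
    exact (h2.mul ((tendsto_inverse_one_sub_smul l).mul_const l)).mono_left nhdsWithin_le_nhds
  have h3 : (fun z : ℂ => (a - z • 1) * (Ring.inverse (1 - z • l) * l)) =ᶠ[𝓝[≠] 0]
      fun _ => 1 := by
    filter_upwards [(eventually_isUnit_one_sub_smul l).filter_mono nhdsWithin_le_nhds, h]
      with z hz hza
    have hleft : (Ring.inverse (1 - z • l) * l) * (a - z • 1) = 1 := by
      rw [mul_assoc, mul_sub, hl, mul_smul_comm, mul_one, Ring.inverse_mul_cancel _ hz]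
    obtain ⟨v, hv⟩ := hza
    rw [← hv] at hleft ⊢
    rw [Units.eq_inv_of_mul_eq_one_right hleft, Units.mul_inv]
  have hal : a * l = 1 := by
    have := tendsto_nhds_unique (h1.congr' h3) tendsto_const_nhds
    simpa using this
  exact ⟨⟨a, l, hal, hl⟩, rfl⟩

end BanachAlgebra

/-! ### Upper triangular operators and their spectra. -/

section UpperTriangular

variable {X : Type*} [NormedAddCommGroup X] [NormedSpace ℂ X]
variable {Y : Type*} [NormedAddCommGroup Y] [NormedSpace ℂ Y]

theorem mem_spectrum_iff_not_isUnit_sub_smul (T : X →L[ℂ] X) (z : ℂ) :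
    z ∈ spectrum ℂ T ↔ ¬ IsUnit (T - z • (1 : X →L[ℂ] X)) := by
  rw [spectrum.mem_iff, ← IsUnit.neg_iff, neg_sub, Algebra.algebraMap_eq_smul_one]

theorem upperTriangularOp_sub_smul (A : X →L[ℂ] X) (B : Y →L[ℂ] Y) (C : Y →L[ℂ] X) (z : ℂ) :
    upperTriangularOp A B C - z • (1 : (X × Y) →L[ℂ] (X × Y)) =
      upperTriangularOp (A - z • 1) (B - z • 1) C := by
  ext p <;> simp [upperTriangularOp]

theorem upperTriangularOp_mul (A A' : X →L[ℂ] X) (B B' : Y →L[ℂ] Y) (C C' : Y →L[ℂ] X) :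
    upperTriangularOp A B C * upperTriangularOp A' B' C' =
      upperTriangularOp (A * A') (B * B') (A.comp C' + C.comp B') := by
  ext p <;> simp [upperTriangularOp]

theorem upperTriangularOp_one :
    upperTriangularOp (1 : X →L[ℂ] X) (1 : Y →L[ℂ] Y) 0 = 1 := by
  ext p <;> simp [upperTriangularOp]

theorem upperTriangularOp_sub (A A' : X →L[ℂ] X) (B B' : Y →L[ℂ] Y) (C C' : Y →L[ℂ] X) :
    upperTriangularOp A B C - upperTriangularOp A' B' C' =
      upperTriangularOp (A - A') (B - B') (C - C') := by
  ext p <;> simp [upperTriangularOp]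

theorem upperTriangularOp_pow (A : X →L[ℂ] X) (B : Y →L[ℂ] Y) (C : Y →L[ℂ] X) (n : ℕ) :
    ∃ E, upperTriangularOp A B C ^ n = upperTriangularOp (A ^ n) (B ^ n) E := by
  induction n with
  | zero => exact ⟨0, by simp [upperTriangularOp_one]⟩
  | succ n ih =>
    obtain ⟨E, hE⟩ := ih
    exact ⟨_, by rw [pow_succ, hE, upperTriangularOp_mul, ← pow_succ, ← pow_succ]⟩

theorem upperTriangularOp_inj {A A' : X →L[ℂ] X} {B B' : Y →L[ℂ] Y} {C C' : Y →L[ℂ] X}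
    (h : upperTriangularOp A B C = upperTriangularOp A' B' C') : A = A' ∧ B = B' := by
  constructor
  · ext x
    have := congrArg (fun T => (T (x, 0)).1) h
    simpa [upperTriangularOp_apply] using this
  · ext y
    have := congrArg (fun T => (T (0, y)).2) h
    simpa [upperTriangularOp_apply] using this

/-- An operator on `X × Y` leaving `X × 0` invariant is upper triangular. -/
theorem exists_eq_upperTriangularOp {T : (X × Y) →L[ℂ] (X × Y)} (h : ∀ x, (T (x, 0)).2 = 0) :
    ∃ A B C, T = upperTriangularOp A B C := by
  refine ⟨(ContinuousLinearMap.fst ℂ X Y).comp (T.comp (ContinuousLinearMap.inl ℂ X Y)),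
    (ContinuousLinearMap.snd ℂ X Y).comp (T.comp (ContinuousLinearMap.inr ℂ X Y)),
    (ContinuousLinearMap.fst ℂ X Y).comp (T.comp (ContinuousLinearMap.inr ℂ X Y)), ?_⟩
  ext p <;> simp [upperTriangularOp, h, show ((0 : X), (0 : Y)) = 0 from rfl]

/-- Stated with explicit triangular inverses because the triangular form of the resolvent is needed
later, not only its existence. -/
theorem isUnit_upperTriangularOp {A : X →L[ℂ] X} {B : Y →L[ℂ] Y} (hA : IsUnit A) (hB : IsUnit B)
    (C : Y →L[ℂ] X) : ∃ A' B' C', upperTriangularOp A' B' C' * upperTriangularOp A B C = 1 ∧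
      upperTriangularOp A B C * upperTriangularOp A' B' C' = 1 := by
  obtain ⟨a, rfl⟩ := hA
  obtain ⟨b, rfl⟩ := hB
  refine ⟨((a⁻¹ : (X →L[ℂ] X)ˣ) : X →L[ℂ] X), ((b⁻¹ : (Y →L[ℂ] Y)ˣ) : Y →L[ℂ] Y),
    -(((a⁻¹ : (X →L[ℂ] X)ˣ) : X →L[ℂ] X).comp (C.comp ((b⁻¹ : (Y →L[ℂ] Y)ˣ) : Y →L[ℂ] Y))),
    ?_, ?_⟩
  · have hb (y : Y) : ((b⁻¹ : (Y →L[ℂ] Y)ˣ) : Y →L[ℂ] Y) ((b : Y →L[ℂ] Y) y) = y :=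
      congrArg (fun T => T y) b.inv_mul
    rw [upperTriangularOp_mul, a.inv_mul, b.inv_mul, ← upperTriangularOp_one]
    congr 1
    ext y
    simp [hb]
  · have ha (x : X) : (a : X →L[ℂ] X) (((a⁻¹ : (X →L[ℂ] X)ˣ) : X →L[ℂ] X) x) = x :=
      congrArg (fun T => T x) a.mul_inv
    rw [upperTriangularOp_mul, a.mul_inv, b.mul_inv, ← upperTriangularOp_one]
    congr 1
    ext y
    simp [ha]

theorem IsUnit.upperTriangularOp {A : X →L[ℂ] X} {B : Y →L[ℂ] Y} (hA : IsUnit A) (hB : IsUnit B)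
    (C : Y →L[ℂ] X) : IsUnit (upperTriangularOp A B C) := by
  obtain ⟨A', B', C', h1, h2⟩ := isUnit_upperTriangularOp hA hB C
  exact ⟨⟨_, _, h2, h1⟩, rfl⟩

/-- `M_C` maps `(x, 0)` to `(A x, 0)`, so the upper left corner of its inverse undoes `A`. -/
theorem exists_left_inverse_of_isUnit_upperTriangularOp {A : X →L[ℂ] X} {B : Y →L[ℂ] Y}
    {C : Y →L[ℂ] X} (h : IsUnit (upperTriangularOp A B C)) : ∃ L : X →L[ℂ] X, L * A = 1 := by
  obtain ⟨v, hv⟩ := h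
  refine ⟨(ContinuousLinearMap.fst ℂ X Y).comp
    (((v⁻¹ : ((X × Y) →L[ℂ] (X × Y))ˣ) : (X × Y) →L[ℂ] (X × Y)).comp
      (ContinuousLinearMap.inl ℂ X Y)), ?_⟩
  ext x
  have h1 := congrArg (fun T : (X × Y) →L[ℂ] (X × Y) => (T (x, 0)).1) v.inv_mul
  rw [hv] at h1
  simpa [upperTriangularOp_apply] using h1

theorem isUnit_of_isUnit_upperTriangularOp [CompleteSpace Y] {A : X →L[ℂ] X}
    {B : Y →L[ℂ] Y} {C : Y →L[ℂ] X} (h : IsUnit (upperTriangularOp A B C)) (hA : IsUnit A) :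
    IsUnit B := by
  obtain ⟨v, hv⟩ := h
  obtain ⟨a, rfl⟩ := hA
  have ha (x : X) : (a : X →L[ℂ] X) (((a⁻¹ : (X →L[ℂ] X)ˣ) : X →L[ℂ] X) x) = x :=
    congrArg (fun T => T x) a.mul_inv
  have h1 (p : X × Y) : (v⁻¹ : ((X × Y) →L[ℂ] (X × Y))ˣ).1 (upperTriangularOp a B C p) = p := by
    rw [← hv]
    exact congrArg (fun T : (X × Y) →L[ℂ] (X × Y) => T p) v.inv_mul
  have h2 (p : X × Y) : upperTriangularOp a B C ((v⁻¹ : ((X × Y) →L[ℂ] (X × Y))ˣ).1 p) = p := by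
    rw [← hv]
    exact congrArg (fun T : (X × Y) →L[ℂ] (X × Y) => T p) v.mul_inv
  rw [ContinuousLinearMap.isUnit_iff_bijective]
  refine ⟨(injective_iff_map_eq_zero B).2 fun y hy => ?_, fun y => ?_⟩
  -- If `B y = 0`, this vector lies in the kernel of the triangular operator.
  · have h3 := h1 (-((a⁻¹ : (X →L[ℂ] X)ˣ) : X →L[ℂ] X) (C y), y)
    rw [upperTriangularOp_apply, map_neg, ha, hy, neg_add_cancel] at h3
    have h4 := congrArg Prod.snd h3
    rw [show ((0 : X), (0 : Y)) = 0 from rfl, map_zero] at h4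
    exact h4.symm
  · exact ⟨((v⁻¹ : ((X × Y) →L[ℂ] (X × Y))ˣ).1 (0, y)).2, congrArg Prod.snd (h2 (0, y))⟩

/-- `M_C` is Drazin invertible when both diagonal entries are. -/
theorem IsDrazinInvertible.upperTriangularOp {A : X →L[ℂ] X} {B : Y →L[ℂ] Y}
    (hA : IsDrazinInvertible A) (hB : IsDrazinInvertible B) (C : Y →L[ℂ] X) :
    IsDrazinInvertible (upperTriangularOp A B C) := by
  obtain ⟨k, hk0, S, hS, hSk, -⟩ := hA
  obtain ⟨l, -, T, hT, hTl, -⟩ := hB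
  obtain ⟨n, hn⟩ : ∃ n, n = k + l := ⟨_, rfl⟩
  set M := _root_.upperTriangularOp A B C with hM
  have hA1 : A ^ (n + (n + 1)) * S ^ (n + 1) = A ^ n := by
    rw [hn]
    exact pow_add_add_mul_pow_of_drazin hSk l _
  have hB1 : B ^ (n + (n + 1)) * T ^ (n + 1) = B ^ n := by
    rw [hn, add_comm k l]
    exact pow_add_add_mul_pow_of_drazin hTl k _
  have hA2 : S ^ (n + 1) * A ^ (n + (n + 1)) = A ^ n := by
    rw [((show Commute S A from hS).pow_pow _ _).eq, hA1]
  have hB2 : T ^ (n + 1) * B ^ (n + (n + 1)) = B ^ n := by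
    rw [((show Commute T B from hT).pow_pow _ _).eq, hB1]
  obtain ⟨E, hE⟩ := upperTriangularOp_pow A B C n
  obtain ⟨F, hF⟩ := upperTriangularOp_pow A B C (n + (n + 1))
  set D := _root_.upperTriangularOp (S ^ (n + 1)) (T ^ (n + 1)) (0 : Y →L[ℂ] X) with hD
  have hsq (G H : Y →L[ℂ] X) : _root_.upperTriangularOp (0 : X →L[ℂ] X) (0 : Y →L[ℂ] Y) G *
      _root_.upperTriangularOp 0 0 H = 0 := by
    ext p <;> simp [_root_.upperTriangularOp]
  -- The difference has zero diagonal, so it squares to zero. Expanding gives `M ^ (2n)` as a right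
  -- multiple of `M ^ (2n + 1)`; this is why `D` has diagonal powers `n + 1`, compensating `n + (n +
  -- 1)`.
  have h1 : (M ^ n - M ^ (n + (n + 1)) * D) * (M ^ n - M ^ (n + (n + 1)) * D) = 0 := by
    rw [hM, hE, hF, hD, upperTriangularOp_mul, hA1, hB1, upperTriangularOp_sub, sub_self, sub_self,
      hsq]
  have h2 : (M ^ n - D * M ^ (n + (n + 1))) * (M ^ n - D * M ^ (n + (n + 1))) = 0 := by
    rw [hM, hE, hF, hD, upperTriangularOp_mul, hA2, hB2, upperTriangularOp_sub, sub_self, sub_self,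
      hsq]
  have h3 : M ^ (n + n + 1) * (D * (M ^ n - M ^ (n + (n + 1)) * D) + M ^ n * D) = M ^ (n + n) := by
    have e : M ^ n * (M ^ (n + (n + 1)) * D) = M ^ (n + n + 1) * (M ^ n * D) := by
      rw [← mul_assoc, ← mul_assoc, ← pow_add, ← pow_add]
      congr 2
      ring
    rw [sub_mul, mul_sub (M ^ n), e, ← pow_add, ← add_assoc, mul_assoc, sub_sub,
      sub_eq_zero] at h1
    rw [mul_add, add_comm]
    exact h1.symm
  have h4 : ((M ^ n - D * M ^ (n + (n + 1))) * D + D * M ^ n) * M ^ (n + n + 1) = M ^ (n + n) := by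
    have e : D * M ^ (n + (n + 1)) * M ^ n = D * M ^ n * M ^ (n + n + 1) := by
      rw [mul_assoc, mul_assoc, ← pow_add, ← pow_add]
      congr 2
      ring
    rw [mul_sub, sub_mul _ _ (M ^ n), e, ← pow_add, ← add_assoc, ← mul_assoc, sub_sub,
      sub_eq_zero] at h2
    rw [add_mul, add_comm]
    exact h2.symm
  obtain ⟨d, hd⟩ := exists_drazin_inverse_of_strongly_pi_regular h3 h4
  exact ⟨n + n, by omega, d, hd⟩

/-- If `M_C` is Drazin invertible and the resolvents of `A` and `B` exist near `0`, then `A` and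
`B` are Drazin invertible: the Drazin inverse of `M_C` is a limit of upper triangular operators. -/
theorem IsDrazinInvertible.of_upperTriangularOp [CompleteSpace X] [CompleteSpace Y]
    {A : X →L[ℂ] X} {B : Y →L[ℂ] Y} {C : Y →L[ℂ] X}
    (h : IsDrazinInvertible (_root_.upperTriangularOp A B C))
    (hA : ∀ᶠ z : ℂ in 𝓝[≠] 0, IsUnit (A - z • 1)) (hB : ∀ᶠ z : ℂ in 𝓝[≠] 0, IsUnit (B - z • 1)) :
    IsDrazinInvertible A ∧ IsDrazinInvertible B := by
  obtain ⟨k, hk0, S, hc, hk, hs⟩ := h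
  -- For small `z ≠ 0` this function equals `(M_C - z)⁻¹ ^ (k + 1) * M_C ^ k`, a product of
  -- triangular operators; leaving `X × 0` invariant passes to the limit `S`.
  have hlim : Tendsto (fun z : ℂ => Ring.inverse (1 - z • S) ^ (k + 1) * S) (𝓝[≠] 0) (𝓝 S) := by
    have := (((tendsto_inverse_one_sub_smul S).pow (k + 1)).mul_const S)
    rw [one_pow, one_mul] at this
    exact this.mono_left nhdsWithin_le_nhds
  have hS : ∀ x, (S (x, 0)).2 = 0 := by
    intro x
    have hev : Continuous fun T : (X × Y) →L[ℂ] (X × Y) => (T (x, 0)).2 := by fun_prop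
    refine tendsto_nhds_unique (((hev.tendsto S).comp hlim).congr' ?_) tendsto_const_nhds
    filter_upwards [hA, hB,
      (eventually_isUnit_one_sub_smul S).filter_mono nhdsWithin_le_nhds] with z hzA hzB hz
    obtain ⟨A', B', C', h1, -⟩ := isUnit_upperTriangularOp hzA hzB C
    rw [← upperTriangularOp_sub_smul] at h1
    have h2 := pow_inverse_mul_pow_of_drazin (z • (1 : (X × Y) →L[ℂ] (X × Y)))
      ((Commute.one_left S).smul_left z) ((Commute.one_left _).smul_left z) hc hk hs h1
      (w := Ring.inverse (1 - z • S))
      (by rw [smul_mul_assoc, one_mul, Ring.mul_inverse_cancel _ hz])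
      (by rw [smul_mul_assoc, one_mul, Ring.inverse_mul_cancel _ hz])
    obtain ⟨E, hE⟩ := upperTriangularOp_pow A' B' C' (k + 1)
    obtain ⟨F, hF⟩ := upperTriangularOp_pow A B C k
    rw [hE, hF, upperTriangularOp_mul] at h2
    simp only [Function.comp_apply]
    rw [← h2, upperTriangularOp_apply]
    exact map_zero _
  obtain ⟨P, Q, V, rfl⟩ := exists_eq_upperTriangularOp hS
  obtain ⟨E, hE⟩ := upperTriangularOp_pow A B C (k + 1)
  obtain ⟨F, hF⟩ := upperTriangularOp_pow A B C k
  rw [hE, hF, upperTriangularOp_mul] at hk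
  rw [upperTriangularOp_mul, upperTriangularOp_mul] at hc
  rw [sq, upperTriangularOp_mul, upperTriangularOp_mul, ← sq, ← sq] at hs
  obtain ⟨hc1, hc2⟩ := upperTriangularOp_inj hc
  obtain ⟨hk1, hk2⟩ := upperTriangularOp_inj hk
  obtain ⟨hs1, hs2⟩ := upperTriangularOp_inj hs
  exact ⟨⟨k, hk0, P, hc1, hk1, hs1⟩, ⟨k, hk0, Q, hc2, hk2, hs2⟩⟩

theorem IsUnit.isDrazinInvertible {T : X →L[ℂ] X} (h : IsUnit T) : IsDrazinInvertible T := by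
  obtain ⟨v, rfl⟩ := h
  refine ⟨1, one_pos, ((v⁻¹ : (X →L[ℂ] X)ˣ) : X →L[ℂ] X), by simp, ?_, ?_⟩
  · rw [pow_succ, mul_assoc, v.mul_inv, mul_one]
  · rw [sq, mul_assoc, v.inv_mul, mul_one]

theorem isGeneralizedDrazinInvertible_sub_smul_iff (T : X →L[ℂ] X) (z : ℂ) :
    IsGeneralizedDrazinInvertible (T - z • (1 : X →L[ℂ] X)) ↔
      ∀ᶠ u : ℂ in 𝓝[≠] 0, IsUnit (T - z • 1 - u • (1 : X →L[ℂ] X)) := by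
  rw [IsGeneralizedDrazinInvertible, accPt_iff_frequently_nhdsNE, not_frequently]
  simp only [mem_spectrum_iff_not_isUnit_sub_smul, not_not]

theorem spectrum_upperTriangularOp_subset (A : X →L[ℂ] X) (B : Y →L[ℂ] Y) (C : Y →L[ℂ] X) :
    spectrum ℂ (upperTriangularOp A B C) ⊆ spectrum ℂ A ∪ spectrum ℂ B := by
  intro z
  simp only [Set.mem_union, mem_spectrum_iff_not_isUnit_sub_smul, upperTriangularOp_sub_smul]
  contrapose!
  exact fun h => h.1.upperTriangularOp h.2 C

/-- Criterion for the spectrum of `M_C` to fill the union: wherever `M_C - z` is invertible, so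
is `A - z`. -/
theorem spectrum_upperTriangularOp_eq_iff [CompleteSpace Y] (A : X →L[ℂ] X)
    (B : Y →L[ℂ] Y) (C : Y →L[ℂ] X) :
    spectrum ℂ (upperTriangularOp A B C) = spectrum ℂ A ∪ spectrum ℂ B ↔
      ∀ z : ℂ, IsUnit (upperTriangularOp (A - z • 1) (B - z • 1) C) → IsUnit (A - z • 1) := by
  constructor
  · intro h z hz
    by_contra hA
    have : z ∈ spectrum ℂ (upperTriangularOp A B C) :=
      h ▸ Or.inl ((mem_spectrum_iff_not_isUnit_sub_smul A z).2 hA)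
    rw [mem_spectrum_iff_not_isUnit_sub_smul, upperTriangularOp_sub_smul] at this
    exact this hz
  · intro h
    refine (spectrum_upperTriangularOp_subset A B C).antisymm fun z hz => ?_
    simp only [Set.mem_union, mem_spectrum_iff_not_isUnit_sub_smul,
      upperTriangularOp_sub_smul] at hz ⊢
    intro hM
    exact hz.elim (fun hA => hA (h z hM))
      fun hB => hB (isUnit_of_isUnit_upperTriangularOp hM (h z hM))

end UpperTriangular

/-! ### The equivalence of the three spectral equalities. -/

theorem mainTheorem4
    {X : Type*} [NormedAddCommGroup X] [NormedSpace ℂ X] [CompleteSpace X]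
    {Y : Type*} [NormedAddCommGroup Y] [NormedSpace ℂ Y] [CompleteSpace Y]
    (A : X →L[ℂ] X) (B : Y →L[ℂ] Y) (C : Y →L[ℂ] X) :
    List.TFAE
      [spectrum ℂ (upperTriangularOp A B C) = spectrum ℂ A ∪ spectrum ℂ B,
       drazinSpectrum (upperTriangularOp A B C) = drazinSpectrum A ∪ drazinSpectrum B,
       generalizedDrazinSpectrum (upperTriangularOp A B C) =
         generalizedDrazinSpectrum A ∪ generalizedDrazinSpectrum B] := by
  have hshift (z u : ℂ) : upperTriangularOp (A - z • 1) (B - z • 1) C - u • 1 =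
      upperTriangularOp (A - (z + u) • 1) (B - (z + u) • 1) C := by
    rw [upperTriangularOp_sub_smul, sub_sub, sub_sub, ← add_smul, ← add_smul]
  have hres (h : spectrum ℂ (upperTriangularOp A B C) = spectrum ℂ A ∪ spectrum ℂ B) (z : ℂ)
      (hz : ∀ᶠ u : ℂ in 𝓝[≠] 0, IsUnit (upperTriangularOp (A - z • 1) (B - z • 1) C - u • 1)) :
      (∀ᶠ u : ℂ in 𝓝[≠] 0, IsUnit (A - z • 1 - u • 1)) ∧
        ∀ᶠ u : ℂ in 𝓝[≠] 0, IsUnit (B - z • 1 - u • 1) := by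
    rw [spectrum_upperTriangularOp_eq_iff] at h
    rw [← eventually_and]
    filter_upwards [hz] with u hu
    rw [hshift] at hu
    rw [sub_sub, sub_sub, ← add_smul, ← add_smul]
    exact ⟨h _ hu, isUnit_of_isUnit_upperTriangularOp hu (h _ hu)⟩
  tfae_have 1 → 2 := by
    intro h
    ext z
    simp only [drazinSpectrum, Set.mem_union, Set.mem_ofPred_eq, upperTriangularOp_sub_smul]
    rw [← not_and_or, not_iff_not]
    refine ⟨fun hM => ?_, fun hAB => hAB.1.upperTriangularOp hAB.2 C⟩
    have hev : ∀ᶠ u : ℂ in 𝓝[≠] 0,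
        IsUnit (upperTriangularOp (A - z • 1) (B - z • 1) C - u • 1) := by
      obtain ⟨k, -, S, hc, hk, hs⟩ := hM
      exact eventually_isUnit_sub_smul_of_drazin hc hk hs
    exact hM.of_upperTriangularOp (hres h z hev).1 (hres h z hev).2
  tfae_have 2 → 1 := by
    intro h
    rw [spectrum_upperTriangularOp_eq_iff]
    intro z hz
    obtain ⟨L, hL⟩ := exists_left_inverse_of_isUnit_upperTriangularOp hz
    have hA : IsDrazinInvertible (A - z • 1) := by
      by_contra hA
      have hmem : z ∈ drazinSpectrum (upperTriangularOp A B C) := h ▸ Or.inl hA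
      rw [drazinSpectrum, Set.mem_ofPred_eq, upperTriangularOp_sub_smul] at hmem
      exact hmem hz.isDrazinInvertible
    obtain ⟨k, -, S, hc, hk, -⟩ := hA
    exact isUnit_of_left_inverse_of_drazin hL hc hk
  tfae_have 1 → 3 := by
    intro h
    ext z
    simp only [generalizedDrazinSpectrum, Set.mem_union, Set.mem_ofPred_eq,
      isGeneralizedDrazinInvertible_sub_smul_iff]
    rw [← not_and_or, not_iff_not, upperTriangularOp_sub_smul]
    refine ⟨hres h z, fun hAB => ?_⟩
    filter_upwards [hAB.1, hAB.2] with u hA hB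
    rw [upperTriangularOp_sub_smul]
    exact hA.upperTriangularOp hB C
  tfae_have 3 → 1 := by
    intro h
    rw [spectrum_upperTriangularOp_eq_iff]
    intro z hz
    obtain ⟨L, hL⟩ := exists_left_inverse_of_isUnit_upperTriangularOp hz
    refine isUnit_of_left_inverse_of_eventually hL ?_
    rw [← isGeneralizedDrazinInvertible_sub_smul_iff]
    by_contra hA
    have hmem : z ∈ generalizedDrazinSpectrum (upperTriangularOp A B C) := h ▸ Or.inl hA
    rw [generalizedDrazinSpectrum, Set.mem_ofPred_eq,
      isGeneralizedDrazinInvertible_sub_smul_iff, upperTriangularOp_sub_smul] at hmem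
    refine hmem (nhdsWithin_le_nhds ?_)
    have hcont : Tendsto (fun u : ℂ => upperTriangularOp (A - z • 1) (B - z • 1) C - u • 1) (𝓝 0)
        (𝓝 (upperTriangularOp (A - z • 1) (B - z • 1) C)) := by
      have : Continuous fun u : ℂ => upperTriangularOp (A - z • 1) (B - z • 1) C -
        u • (1 : (X × Y) →L[ℂ] (X × Y)) := by fun_prop
      simpa using this.tendsto 0
    exact hcont.eventually (Units.isOpen.mem_nhds hz)
  tfae_finish
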